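/- Let $\sigma>0$, let $X$ be a real random variable with an arbitrary distribution $P_X$, let $N\sim\mathcal N(0,\sigma^2)$ be independent of $X$, and let $Y=X+N$. Write $\phi_{\sigma^2}$ for the density of $\mathcal N(0,\sigma^2)$ and $f_Y(y)=\mathbb E[\phi_{\sigma^2}(y-X)]>0$ for the density of $Y$. For every $y\in\mathbb R$ let $P_{X|Y=y}$ be the probability measure given by Bayes' formula, $dP_{X|Y=y}(x)=\frac{\phi_{\sigma^2}(y-x)}{f_Y(y)}\,dP_X(x)$; the family $(P_{X|Y=y})_{y\in\mathbb R}$ is a version of the regular conditional distribution of $X$ given $Y$. Put $\mathbb E[X|Y=y]=\int x\,dP_{X|Y=y}(x)$, and let $$\kappa_{X|Y=y}(k)=\frac{d^k}{dt^k}\log\Big(\int e^{tx}\,dP_{X|Y=y}(x)\Big)\Big|_{t=0},\qquad k\ge 1,$$ be the conditional cumulants. Then for every $a\in\mathbb R$ the radius of convergence $r_{\sigma,a}\in[0,\infty]$ of the power series $\sum_{k\ge0}\frac{\kappa_{X|Y=a}(k+1)}{k!\,\sigma^{2k}}(y-a)^k$ satisfies $r_{\sigma,a}>0$, and $$\mathbb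 E[X|Y=y]=\sum_{k=0}^\infty\frac{\kappa_{X|Y=a}(k+1)}{k!\,\sigma^{2k}}\,(y-a)^k\qquad\text{for all real } y \text{ with } |y-a|<r_{\sigma,a}.$$ In addition, if $|X|\le A$ almost surely for some $A>0$, then $r_{\sigma,a}\ge\frac{\sigma^2}{2Ae}$. -/

import Mathlib

open MeasureTheory ProbabilityTheory
open scoped NNReal ENNReal Nat

noncomputable section

namespace GaussianChannel

/-- If `X` has law `μ` and `N ∼ 𝒩(0, σ²)` is independent of `X`, this is the probability density
function `f_Y` of `Y = X + N`, i.e. `f_Y(y) = 𝔼[φ_{σ²}(y - X)]`. -/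
def outputDensity (μ : Measure ℝ) (σ : ℝ≥0) (y : ℝ) : ℝ :=
  ∫ x, gaussianPDFReal 0 (σ ^ 2) (y - x) ∂μ

/-- The conditional law `P_{X | Y = y}` of `X ∼ μ` given `Y = X + N = y`, as given for every
real `y` by Bayes' formula: it has density `x ↦ φ_{σ²}(y - x) / f_Y(y)` with respect to `μ`. -/
def condLaw (μ : Measure ℝ) (σ : ℝ≥0) (y : ℝ) : Measure ℝ :=
  μ.withDensity fun x =>
    ENNReal.ofReal (gaussianPDFReal 0 (σ ^ 2) (y - x) / outputDensity μ σ y)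

/-- The conditional mean `𝔼[X | Y = y] = ∫ x dP_{X | Y = y}(x)`. -/
def condMean (μ : Measure ℝ) (σ : ℝ≥0) (y : ℝ) : ℝ :=
  ∫ x, x ∂(condLaw μ σ y)

/-- The conditional cumulant generating function `K_X(t | Y = y) = log 𝔼[exp (t X) | Y = y]`. -/
def condCGF (μ : Measure ℝ) (σ : ℝ≥0) (y t : ℝ) : ℝ :=
  cgf id (condLaw μ σ y) t

/-- The `k`-th conditional cumulant `κ_{X | Y = y}(k)`: the `k`-th derivative at `t = 0` of
`t ↦ K_X(t | Y = y)`. -/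
def condCumulant (μ : Measure ℝ) (σ : ℝ≥0) (y : ℝ) (k : ℕ) : ℝ :=
  iteratedDeriv k (condCGF μ σ y) 0

/-! Sanity facts: `condLaw` is a probability measure with all exponential moments, and it is a
version of the regular conditional distribution of `X` given `Y = X + N`. -/

theorem measurable_kernelDensity (σ : ℝ≥0) :
    Measurable fun p : ℝ × ℝ => gaussianPDFReal 0 (σ ^ 2) (p.1 - p.2) :=
  (measurable_gaussianPDFReal 0 (σ ^ 2)).comp (measurable_fst.sub measurable_snd)

theorem gaussianPDFReal_le (σ : ℝ≥0) (x : ℝ) :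
    gaussianPDFReal 0 (σ ^ 2) x ≤ (√(2 * Real.pi * (σ ^ 2 : ℝ≥0)))⁻¹ := by
  rw [gaussianPDFReal]
  refine mul_le_of_le_one_right (by positivity) (Real.exp_le_one_iff.2 ?_)
  rw [neg_div]
  exact neg_nonpos.2 (by positivity)

theorem integrable_kernelDensity (μ : Measure ℝ) [IsProbabilityMeasure μ] (σ : ℝ≥0) (y : ℝ) :
    Integrable (fun x => gaussianPDFReal 0 (σ ^ 2) (y - x)) μ := by
  refine Integrable.of_bound (C := (√(2 * Real.pi * (σ ^ 2 : ℝ≥0)))⁻¹)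
    ((measurable_gaussianPDFReal 0 (σ ^ 2)).comp
      (measurable_const.sub measurable_id)).aestronglyMeasurable ?_
  refine Filter.Eventually.of_forall fun x => ?_
  rw [Real.norm_of_nonneg (gaussianPDFReal_nonneg _ _ _)]
  exact gaussianPDFReal_le σ _

theorem outputDensity_pos (μ : Measure ℝ) [IsProbabilityMeasure μ] {σ : ℝ≥0} (hσ : 0 < σ) (y : ℝ) :
    0 < outputDensity μ σ y := by
  have hv : σ ^ 2 ≠ 0 := (pow_pos hσ 2).ne'
  rw [outputDensity, integral_pos_iff_support_of_nonneg
    (fun _ => gaussianPDFReal_nonneg _ _ _) (integrable_kernelDensity μ σ y)]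
  have : Function.support (fun x => gaussianPDFReal 0 (σ ^ 2) (y - x)) = Set.univ :=
    Set.eq_univ_of_forall fun x => (gaussianPDFReal_pos _ _ _ hv).ne'
  rw [this]
  simp

theorem ofReal_outputDensity (μ : Measure ℝ) [IsProbabilityMeasure μ] (σ : ℝ≥0) (y : ℝ) :
    ENNReal.ofReal (outputDensity μ σ y) =
      ∫⁻ x, ENNReal.ofReal (gaussianPDFReal 0 (σ ^ 2) (y - x)) ∂μ :=
  ofReal_integral_eq_lintegral_ofReal (integrable_kernelDensity μ σ y)
    (Filter.Eventually.of_forall fun _ => gaussianPDFReal_nonneg _ _ _)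

theorem measurable_outputDensity (μ : Measure ℝ) [IsProbabilityMeasure μ] (σ : ℝ≥0) :
    Measurable (outputDensity μ σ) :=
  ((measurable_kernelDensity σ).stronglyMeasurable.integral_prod_right (ν := μ)).measurable

theorem isProbabilityMeasure_condLaw (μ : Measure ℝ) [IsProbabilityMeasure μ] {σ : ℝ≥0}
    (hσ : 0 < σ) (y : ℝ) : IsProbabilityMeasure (condLaw μ σ y) := by
  have hpos := outputDensity_pos μ hσ y
  constructor
  rw [condLaw, withDensity_apply _ MeasurableSet.univ, Measure.restrict_univ,
    ← ofReal_integral_eq_lintegral_ofReal ((integrable_kernelDensity μ σ y).div_const _)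
      (Filter.Eventually.of_forall fun x => div_nonneg (gaussianPDFReal_nonneg _ _ _) hpos.le),
    integral_div]
  have : (∫ x, gaussianPDFReal 0 (σ ^ 2) (y - x) ∂μ) = outputDensity μ σ y := rfl
  rw [this, div_self hpos.ne', ENNReal.ofReal_one]

/-- All exponential moments of `P_{X | Y = y}` are finite. -/
theorem integrable_exp_condLaw (μ : Measure ℝ) [IsProbabilityMeasure μ] {σ : ℝ≥0}
    (hσ : 0 < σ) (y t : ℝ) : Integrable (fun x => Real.exp (t * x)) (condLaw μ σ y) := by
  have hpos := outputDensity_pos μ hσ y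
  have hm : Measurable fun x => gaussianPDFReal 0 (σ ^ 2) (y - x) :=
    (measurable_gaussianPDFReal 0 (σ ^ 2)).comp (measurable_const.sub measurable_id)
  rw [condLaw, integrable_withDensity_iff (hm.div_const _).ennreal_ofReal
    (Filter.Eventually.of_forall fun x => ENNReal.ofReal_lt_top)]
  have hs : (0 : ℝ) < (σ : ℝ) ^ 2 := by positivity
  set C : ℝ := (√(2 * Real.pi * (σ ^ 2 : ℝ≥0)))⁻¹ with hC
  refine Integrable.of_bound (C := Real.exp (t * y + t ^ 2 * σ ^ 2 / 2) * (C / outputDensity μ σ y))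
    (by fun_prop) (Filter.Eventually.of_forall fun x => ?_)
  rw [ENNReal.toReal_ofReal (div_nonneg (gaussianPDFReal_nonneg _ _ _) hpos.le),
    Real.norm_of_nonneg (mul_nonneg (Real.exp_nonneg _)
      (div_nonneg (gaussianPDFReal_nonneg _ _ _) hpos.le)), mul_div_assoc', mul_div_assoc']
  refine div_le_div_of_nonneg_right ?_ hpos.le
  rw [gaussianPDFReal, ← hC, mul_left_comm, mul_comm (Real.exp (t * y + _)), ← Real.exp_add]
  refine mul_le_mul_of_nonneg_left (Real.exp_le_exp.2 ?_) (by positivity)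
  have key : t * y + t ^ 2 * σ ^ 2 / 2 -
      (t * x + -(y - x - 0) ^ 2 / (2 * ((σ ^ 2 : ℝ≥0) : ℝ))) =
      (y - x + t * (σ : ℝ) ^ 2) ^ 2 / (2 * (σ : ℝ) ^ 2) := by
    push_cast
    field_simp
    ring
  have : 0 ≤ (y - x + t * (σ : ℝ) ^ 2) ^ 2 / (2 * (σ : ℝ) ^ 2) := by positivity
  linarith

set_option maxHeartbeats 400000 in
/-- `y ↦ condLaw (P.map X) σ y` is a version of the regular conditional distribution of `X` given
`Y = X + N`. -/
theorem condDistrib_ae_eq_condLaw {Ω : Type*} [MeasurableSpace Ω] (P : Measure Ω)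
    [IsProbabilityMeasure P] {σ : ℝ≥0} (hσ : 0 < σ) {X N Y : Ω → ℝ} (hX : AEMeasurable X P)
    (hN : HasLaw N (gaussianReal 0 (σ ^ 2)) P) (hXN : IndepFun X N P)
    (hY : ∀ ω, Y ω = X ω + N ω) :
    ∀ᵐ y ∂(P.map Y), condDistrib X Y P y = condLaw (P.map X) σ y := by
  obtain rfl : Y = fun ω => X ω + N ω := funext hY
  have hv : σ ^ 2 ≠ 0 := (pow_pos hσ 2).ne'
  have hNm : AEMeasurable N P := hN.aemeasurable
  have hYm : AEMeasurable (fun ω => X ω + N ω) P := hX.add hNm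
  set μ := P.map X with hμ
  have : IsProbabilityMeasure μ := Measure.isProbabilityMeasure_map hX
  have hd : Measurable (Function.uncurry fun y x : ℝ =>
      ENNReal.ofReal (gaussianPDFReal 0 (σ ^ 2) (y - x) / outputDensity μ σ y)) :=
    ((measurable_kernelDensity σ).div
      ((measurable_outputDensity μ σ).comp measurable_fst)).ennreal_ofReal
  have hg : Measurable fun p : ℝ × ℝ => ENNReal.ofReal (gaussianPDFReal 0 (σ ^ 2) (p.1 - p.2)) :=
    (measurable_kernelDensity σ).ennreal_ofReal
  let κ : Kernel ℝ ℝ := Kernel.withDensity (Kernel.const ℝ μ) fun y x =>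
    ENNReal.ofReal (gaussianPDFReal 0 (σ ^ 2) (y - x) / outputDensity μ σ y)
  have hκ : ∀ y, κ y = condLaw μ σ y := fun y => by
    rw [Kernel.withDensity_apply _ hd, Kernel.const_apply]; rfl
  have : IsMarkovKernel κ := ⟨fun y => by
    rw [hκ]; exact isProbabilityMeasure_condLaw μ hσ y⟩
  -- the joint law, integrated against a test function
  have joint : ∀ f : ℝ × ℝ → ℝ≥0∞, Measurable f →
      ∫⁻ p, f p ∂(P.map fun ω => (X ω + N ω, X ω)) =
        ∫⁻ y, ∫⁻ x, f (y, x) * ENNReal.ofReal (gaussianPDFReal 0 (σ ^ 2) (y - x)) ∂μ := by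
    intro f hf
    have h1 : P.map (fun ω => (X ω + N ω, X ω)) =
        (μ.prod (gaussianReal 0 (σ ^ 2))).map fun p : ℝ × ℝ => (p.1 + p.2, p.1) := by
      rw [← hN.map_eq, hμ, ← (indepFun_iff_map_prod_eq_prod_map_map hX hNm).1 hXN,
        AEMeasurable.map_map_of_aemeasurable (by fun_prop) (by fun_prop)]
      rfl
    rw [h1, lintegral_map hf (by fun_prop), lintegral_prod _ (by fun_prop)]
    have h2 : ∀ x : ℝ, ∫⁻ n, f (x + n, x) ∂(gaussianReal 0 (σ ^ 2)) =
        ∫⁻ y, f (y, x) * ENNReal.ofReal (gaussianPDFReal 0 (σ ^ 2) (y - x)) := by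
      intro x
      rw [gaussianReal_of_var_ne_zero _ hv, lintegral_withDensity_eq_lintegral_mul _
        (measurable_gaussianPDF _ _) (by fun_prop),
        ← lintegral_add_left_eq_self (μ := volume)
          (fun y => f (y, x) * ENNReal.ofReal (gaussianPDFReal 0 (σ ^ 2) (y - x))) x]
      refine lintegral_congr fun n => ?_
      simp [gaussianPDF, mul_comm]
    simp_rw [h2]
    rw [lintegral_lintegral_swap]
    exact ((hf.comp measurable_swap).mul (hg.comp measurable_swap)).aemeasurable
  -- the law of `Y`
  have law : P.map (fun ω => X ω + N ω) =
      volume.withDensity fun y => ENNReal.ofReal (outputDensity μ σ y) := by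
    refine Measure.ext_of_lintegral _ fun f hf => ?_
    have h3 := joint (fun p => f p.1) (hf.comp measurable_fst)
    rw [lintegral_map' (by fun_prop) (by fun_prop)] at h3 ⊢
    have hYd : Measurable fun y => ENNReal.ofReal (outputDensity μ σ y) :=
      (measurable_outputDensity μ σ).ennreal_ofReal
    refine (h3.trans ?_).trans (lintegral_withDensity_eq_lintegral_mul volume hYd hf).symm
    refine lintegral_congr fun y => ?_
    have hgy : Measurable fun x => ENNReal.ofReal (gaussianPDFReal 0 (σ ^ 2) (y - x)) :=
      by fun_prop
    rw [Pi.mul_apply, ofReal_outputDensity]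
    exact (lintegral_const_mul (f y) hgy).trans (mul_comm _ _)
  have main : P.map (fun ω => (X ω + N ω, X ω)) = P.map (fun ω => X ω + N ω) ⊗ₘ κ := by
    refine Measure.ext_of_lintegral _ fun f hf => ?_
    have hYd : Measurable fun y => ENNReal.ofReal (outputDensity μ σ y) :=
      (measurable_outputDensity μ σ).ennreal_ofReal
    have hin : Measurable fun y => ∫⁻ x, f (y, x) ∂(κ y) := hf.lintegral_kernel_prod_right'
    rw [joint f hf, Measure.lintegral_compProd hf, law]
    refine Eq.trans ?_ (lintegral_withDensity_eq_lintegral_mul volume hYd hin).symm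
    refine lintegral_congr fun y => ?_
    have hy := outputDensity_pos μ hσ y
    have hfy : Measurable fun x => f (y, x) := hf.comp (measurable_const.prodMk measurable_id)
    have hdy : Measurable fun x =>
        ENNReal.ofReal (gaussianPDFReal 0 (σ ^ 2) (y - x) / outputDensity μ σ y) :=
      (((measurable_gaussianPDFReal 0 (σ ^ 2)).comp
        (measurable_const.sub measurable_id)).div_const _).ennreal_ofReal
    rw [Pi.mul_apply, hκ, condLaw]
    refine Eq.trans ?_ (congrArg (ENNReal.ofReal (outputDensity μ σ y) * ·)
      (lintegral_withDensity_eq_lintegral_mul μ hdy hfy).symm)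
    refine Eq.trans ?_ (lintegral_const_mul _ (hdy.mul hfy))
    refine lintegral_congr fun x => ?_
    simp only [Pi.mul_apply]
    rw [← mul_assoc, ← ENNReal.ofReal_mul hy.le, mul_div_cancel₀ _ hy.ne', mul_comm]
  filter_upwards [condDistrib_ae_eq_of_measure_eq_compProd (μ := P) _ hX main] with y hy
  rw [hy, hκ]

end GaussianChannel

end

namespace GaussianChannel

/-! Changing the observation from `a` to `y` multiplies the Gaussian kernel by `exp ((y - a) x /
σ²)` up to a factor free of `x`. So `P_{X|Y=y}` is an exponential tilt of `P_{X|Y=a}`, and its mean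
is the derivative of the cumulant generating function at `a`, taken at `(y - a) / σ²`
(`condMean_eq_deriv_condCGF`). The series is thus the Taylor series of the conditional mean. All
exponential moments are finite, so the mean is real analytic on the whole line; this gives a
positive radius, and the identity theorem gives equality on the full interval of convergence.

For `|X| ≤ A` the mean extends to a complex disc as the logarithmic derivative of the complex MGF,
which has no zeros near the origin. Uniqueness of power series then bounds the radius from below. -/

theorem integral_condLaw (μ : Measure ℝ) [IsProbabilityMeasure μ] {σ : ℝ≥0} (hσ : 0 < σ) (y : ℝ)
    (f : ℝ → ℝ) :
    ∫ x, f x ∂(condLaw μ σ y) =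
      (∫ x, f x * gaussianPDFReal 0 (σ ^ 2) (y - x) ∂μ) / outputDensity μ σ y := by
  have hpos := outputDensity_pos μ hσ y
  have hm : Measurable fun x => gaussianPDFReal 0 (σ ^ 2) (y - x) :=
    (measurable_gaussianPDFReal 0 (σ ^ 2)).comp (measurable_const.sub measurable_id)
  rw [condLaw, integral_withDensity_eq_integral_toReal_smul (hm.div_const _).ennreal_ofReal
    (Filter.Eventually.of_forall fun x => ENNReal.ofReal_lt_top), ← integral_div]
  refine integral_congr_ae (Filter.Eventually.of_forall fun x => ?_)
  simp only [smul_eq_mul]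
  rw [ENNReal.toReal_ofReal (div_nonneg (gaussianPDFReal_nonneg _ _ _) hpos.le)]
  ring

/-- Moving the observation from `a` to `y` tilts the Gaussian kernel exponentially. -/
theorem exists_gaussianPDFReal_sub_eq {σ : ℝ≥0} (hσ : 0 < σ) (a y : ℝ) :
    ∃ c : ℝ, 0 < c ∧ ∀ x, Real.exp ((y - a) / (σ : ℝ) ^ 2 * x) *
      gaussianPDFReal 0 (σ ^ 2) (a - x) = c * gaussianPDFReal 0 (σ ^ 2) (y - x) := by
  have hs : (σ : ℝ) ≠ 0 := by exact_mod_cast hσ.ne'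
  -- The `x²` terms of the two exponents agree and the tilt absorbs the cross terms, leaving this
  -- constant.
  refine ⟨Real.exp ((y ^ 2 - a ^ 2) / (2 * (σ : ℝ) ^ 2)), Real.exp_pos _, fun x => ?_⟩
  simp only [gaussianPDFReal]
  rw [mul_left_comm, mul_left_comm (Real.exp ((y ^ 2 - a ^ 2) / (2 * (σ : ℝ) ^ 2))),
    ← Real.exp_add, ← Real.exp_add]
  congr 2
  push_cast
  field_simp
  ring

theorem integrableExpSet_condLaw (μ : Measure ℝ) [IsProbabilityMeasure μ] {σ : ℝ≥0} (hσ : 0 < σ)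
    (a : ℝ) : integrableExpSet id (condLaw μ σ a) = Set.univ :=
  Set.eq_univ_of_forall fun t => integrable_exp_condLaw μ hσ a t

theorem mem_interior_integrableExpSet_condLaw (μ : Measure ℝ) [IsProbabilityMeasure μ] {σ : ℝ≥0}
    (hσ : 0 < σ) (a t : ℝ) : t ∈ interior (integrableExpSet id (condLaw μ σ a)) := by
  simp [integrableExpSet_condLaw μ hσ a]

theorem condMean_eq_deriv_condCGF (μ : Measure ℝ) [IsProbabilityMeasure μ] {σ : ℝ≥0} (hσ : 0 < σ)
    (a y : ℝ) : condMean μ σ y = deriv (condCGF μ σ a) ((σ : ℝ)⁻¹ ^ 2 * (y - a)) := by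
  obtain ⟨c, hc, h⟩ := exists_gaussianPDFReal_sub_eq hσ a y
  have ht : (σ : ℝ)⁻¹ ^ 2 * (y - a) = (y - a) / (σ : ℝ) ^ 2 := by
    rw [inv_pow, mul_comm, div_eq_mul_inv]
  have hy := outputDensity_pos μ hσ y
  have ha := outputDensity_pos μ hσ a
  rw [ht]
  change _ = deriv (cgf id (condLaw μ σ a)) _
  rw [deriv_cgf (mem_interior_integrableExpSet_condLaw μ hσ a _), mgf, condMean,
    integral_condLaw μ hσ, integral_condLaw μ hσ, integral_condLaw μ hσ]
  simp only [id, mul_assoc, h]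
  simp only [mul_left_comm _ c, integral_const_mul]
  -- The tilted MGF is `c f_Y(y) / f_Y(a)`; both `c` and `f_Y(a)` cancel against the numerator.
  change _ = _ / (c * outputDensity μ σ y / _)
  field_simp

theorem analyticAt_deriv_condCGF (μ : Measure ℝ) [IsProbabilityMeasure μ] {σ : ℝ≥0} (hσ : 0 < σ)
    (a t : ℝ) : AnalyticAt ℝ (deriv (condCGF μ σ a)) t :=
  (analyticAt_cgf (mem_interior_integrableExpSet_condLaw μ hσ a t)).deriv

theorem analyticAt_condMean (μ : Measure ℝ) [IsProbabilityMeasure μ] {σ : ℝ≥0} (hσ : 0 < σ)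
    (y : ℝ) : AnalyticAt ℝ (condMean μ σ) y := by
  rw [funext (condMean_eq_deriv_condCGF μ hσ 0)]
  exact (analyticAt_deriv_condCGF μ hσ 0 _).comp (f := fun y : ℝ => (σ : ℝ)⁻¹ ^ 2 * (y - 0))
    (by fun_prop)

theorem iteratedDeriv_condMean (μ : Measure ℝ) [IsProbabilityMeasure μ] {σ : ℝ≥0} (hσ : 0 < σ)
    (a : ℝ) (k : ℕ) :
    iteratedDeriv k (condMean μ σ) a = condCumulant μ σ a (k + 1) / (σ : ℝ) ^ (2 * k) := by
  have hd : ContDiff ℝ k (deriv (condCGF μ σ a)) :=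
    contDiff_iff_contDiffAt.2 fun t => (analyticAt_deriv_condCGF μ hσ a t).contDiffAt
  rw [funext (condMean_eq_deriv_condCGF μ hσ a),
    iteratedDeriv_comp_sub_const (f := fun t => deriv (condCGF μ σ a) ((σ : ℝ)⁻¹ ^ 2 * t)),
    iteratedDeriv_comp_const_mul hd, condCumulant, iteratedDeriv_succ']
  simp only [sub_self, mul_zero]
  rw [← pow_mul, inv_pow, div_eq_inv_mul]

theorem taylorCoeff_condMean (μ : Measure ℝ) [IsProbabilityMeasure μ] {σ : ℝ≥0} (hσ : 0 < σ)
    (a : ℝ) : (fun k : ℕ => iteratedDeriv k (condMean μ σ) a / k !) =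
      fun k : ℕ => condCumulant μ σ a (k + 1) / ((k ! : ℝ) * (σ : ℝ) ^ (2 * k)) := by
  funext k
  rw [iteratedDeriv_condMean μ hσ, div_div, mul_comm]

/-- The moment generating function of a probability measure on `[-A, A]` has no zero in the disc
of radius `1 / (2 A)`. -/
theorem complexMGF_ne_zero_of_norm_lt {ν : Measure ℝ} [IsProbabilityMeasure ν] {A : ℝ}
    (hA : 0 < A) (hν : ∀ᵐ x ∂ν, |x| ≤ A) {z : ℂ} (hz : ‖z‖ < 1 / (2 * A)) :
    complexMGF id ν z ≠ 0 := by
  -- Used twice: it makes `‖z x‖ ≤ 1`, so that `‖exp (z x) - 1‖ ≤ 2 ‖z x‖`, and it keeps the MGF at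
  -- distance less than 1 from 1.
  have hzA : 2 * (‖z‖ * A) < 1 := by
    rw [lt_div_iff₀ (by positivity)] at hz
    linarith
  have hb : ∀ᵐ x : ℝ ∂ν, ‖Complex.exp (z * (x : ℂ)) - 1‖ ≤ 2 * (‖z‖ * A) := by
    filter_upwards [hν] with x hx
    have hzx : ‖z * (x : ℂ)‖ ≤ ‖z‖ * A := by
      rw [norm_mul, Complex.norm_real, Real.norm_eq_abs]
      gcongr
    exact (Complex.norm_exp_sub_one_le (hzx.trans (by linarith))).trans (by linarith)
  have hi : Integrable (fun x : ℝ => Complex.exp (z * (x : ℂ)) - 1) ν :=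
    Integrable.of_bound (by fun_prop) _ hb
  have hi' : Integrable (fun x : ℝ => Complex.exp (z * (x : ℂ))) ν :=
    (hi.add (integrable_const (1 : ℂ))).congr
      (Filter.Eventually.of_forall fun _ => sub_add_cancel _ _)
  have hle : ‖complexMGF id ν z - 1‖ ≤ 2 * (‖z‖ * A) := by
    have h1 : complexMGF id ν z - 1 = ∫ x : ℝ, (Complex.exp (z * (x : ℂ)) - 1) ∂ν := by
      rw [integral_sub hi' (integrable_const _)]
      simp [complexMGF]
    rw [h1]
    simpa using norm_integral_le_of_norm_le_const hb
  intro h0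
  rw [h0] at hle
  simp only [zero_sub, norm_neg, norm_one] at hle
  linarith

/-- Using the quotient `M' / M` avoids choosing a branch of the complex logarithm; at real points
numerator and denominator are both real. -/
theorem re_logDeriv_complexMGF_ofReal {ν : Measure ℝ} {t : ℝ}
    (ht : t ∈ interior (integrableExpSet id ν)) :
    (deriv (complexMGF id ν) t / complexMGF id ν t).re = deriv (cgf id ν) t := by
  have hd : deriv (complexMGF id ν) (t : ℂ) = ((∫ x, id x * Real.exp (t * id x) ∂ν : ℝ) : ℂ) := by
    rw [(hasDerivAt_complexMGF (by simpa using ht)).deriv, ← integral_complex_ofReal]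
    simp
  rw [hd, complexMGF_ofReal, deriv_cgf ht, ← Complex.ofReal_div, Complex.ofReal_re]

theorem ae_condLaw_of_ae {μ : Measure ℝ} {p : ℝ → Prop} (h : ∀ᵐ x ∂μ, p x) (σ : ℝ≥0) (y : ℝ) :
    ∀ᵐ x ∂(condLaw μ σ y), p x :=
  (withDensity_absolutelyContinuous μ _).ae_le h

/-- For a bounded input, the conditional mean is the sum of a power series around `a` on the ball
of radius `σ² ρ` whenever `ρ < 1 / (2 A)`. -/
theorem exists_hasFPowerSeriesOnBall_condMean (μ : Measure ℝ) [IsProbabilityMeasure μ] {σ : ℝ≥0}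
    (hσ : 0 < σ) {A : ℝ} (hA : 0 < A) (hμ : ∀ᵐ x ∂μ, |x| ≤ A) (a : ℝ) {R : ℝ≥0} (hR : 0 < R)
    (hRA : (R : ℝ) < (σ : ℝ) ^ 2 / (2 * A)) :
    ∃ q : FormalMultilinearSeries ℝ ℝ ℝ, HasFPowerSeriesOnBall (condMean μ σ) q a R := by
  have := isProbabilityMeasure_condLaw μ hσ a
  set ν := condLaw μ σ a
  have hs : (0 : ℝ) < (σ : ℝ) ^ 2 := by positivity
  have hM : Differentiable ℂ (complexMGF id ν) := fun z =>
    (hasDerivAt_complexMGF (mem_interior_integrableExpSet_condLaw μ hσ a _)).differentiableAt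
  let u : ℂ → ℂ := fun w => ((σ : ℂ)⁻¹ ^ 2) * (w - a)
  have hu : Differentiable ℂ u := by fun_prop
  have hne : ∀ w ∈ Metric.closedBall (a : ℂ) R, complexMGF id ν (u w) ≠ 0 := fun w hw => by
    refine complexMGF_ne_zero_of_norm_lt hA (ae_condLaw_of_ae hμ σ a) ?_
    rw [mem_closedBall_iff_norm] at hw
    calc ‖u w‖ = (σ : ℝ)⁻¹ ^ 2 * ‖w - a‖ := by simp [u]
      _ ≤ (σ : ℝ)⁻¹ ^ 2 * R := by gcongr
      _ < (σ : ℝ)⁻¹ ^ 2 * ((σ : ℝ) ^ 2 / (2 * A)) := by gcongr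
      _ = 1 / (2 * A) := by field_simp
  have hG : DifferentiableOn ℂ
      (fun w => deriv (complexMGF id ν) (u w) / complexMGF id ν (u w))
      (Metric.closedBall (a : ℂ) R) :=
    ((hM.deriv.comp hu).differentiableOn).div ((hM.comp hu).differentiableOn) hne
  have hP := (hG.hasFPowerSeriesOnBall hR).restrictScalars (𝕜 := ℝ)
  have hQ := Complex.reCLM.comp_hasFPowerSeriesOnBall
    (hP.compContinuousLinearMap (u := Complex.ofRealCLM) (x := a))
  refine ⟨_, (hQ.congr ?_).mono (by exact_mod_cast hR) ?_⟩
  · intro y _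
    have hy : u y = (((σ : ℝ)⁻¹ ^ 2 * (y - a) : ℝ) : ℂ) := by simp [u]
    simp only [Function.comp_apply, Complex.ofRealCLM_apply, Complex.reCLM_apply]
    rw [hy, re_logDeriv_complexMGF_ofReal (mem_interior_integrableExpSet_condLaw μ hσ a _),
      condMean_eq_deriv_condCGF μ hσ a y]
    rfl
  -- Restriction along `ℝ → ℂ` divides the radius by the norm of `Complex.ofRealCLM`, which is 1.
  · simp [← ofReal_norm]

end GaussianChannel

theorem mainTheorem8 {Ω : Type*} [MeasurableSpace Ω] (P : Measure Ω) [IsProbabilityMeasure P]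
    (σ : ℝ≥0) (hσ : 0 < σ) (X N Y : Ω → ℝ) (hX : AEMeasurable X P)
    (hN : HasLaw N (gaussianReal 0 (σ ^ 2)) P) (hXN : IndepFun X N P)
    (hY : ∀ ω, Y ω = X ω + N ω) :
    (∀ᵐ y ∂(P.map Y), condDistrib X Y P y = GaussianChannel.condLaw (P.map X) σ y) ∧
    ∀ a : ℝ, ∃ r : ℝ≥0∞,
      r = (FormalMultilinearSeries.ofScalars ℝ fun k : ℕ =>
        GaussianChannel.condCumulant (P.map X) σ a (k + 1) /
          ((k ! : ℝ) * (σ : ℝ) ^ (2 * k))).radius ∧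
      0 < r ∧
      (∀ y : ℝ, ENNReal.ofReal |y - a| < r →
        HasSum
          (fun k : ℕ => GaussianChannel.condCumulant (P.map X) σ a (k + 1) /
            ((k ! : ℝ) * (σ : ℝ) ^ (2 * k)) * (y - a) ^ k)
          (GaussianChannel.condMean (P.map X) σ y)) ∧
      ∀ A : ℝ, 0 < A → (∀ᵐ ω ∂P, |X ω| ≤ A) →
        ENNReal.ofReal ((σ : ℝ) ^ 2 / (2 * A * Real.exp 1)) ≤ r := by
  refine ⟨GaussianChannel.condDistrib_ae_eq_condLaw P hσ hX hN hXN hY, fun a => ⟨_, rfl, ?_⟩⟩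
  have : IsProbabilityMeasure (P.map X) := Measure.isProbabilityMeasure_map hX
  have hF := GaussianChannel.analyticAt_condMean (P.map X) hσ
  rw [← GaussianChannel.taylorCoeff_condMean (P.map X) hσ a]
  have hat := (hF a).hasFPowerSeriesAt
  -- Analyticity on all of `ℝ` upgrades the local expansion to the whole ball of convergence.
  have hball := AnalyticOn.hasFPowerSeriesOnBall hat.radius_pos
    fun y _ => (hF y).analyticWithinAt
  refine ⟨hat.radius_pos, fun y hy => ?_, fun A hA hXA => ?_⟩
  · have hmem : y - a ∈ Metric.eball (0 : ℝ)
        (FormalMultilinearSeries.ofScalars ℝ fun k : ℕ =>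
          iteratedDeriv k (GaussianChannel.condMean (P.map X) σ) a / k !).radius := by
      rwa [Metric.mem_eball, edist_zero_right, ← ofReal_norm, Real.norm_eq_abs]
    have hsum := hball.hasSum hmem
    rw [add_sub_cancel] at hsum
    convert! hsum using 2 with k
    rw [FormalMultilinearSeries.ofScalars_apply_eq,
      ← congrFun (GaussianChannel.taylorCoeff_condMean (P.map X) hσ a) k, smul_eq_mul]
  · have hpos : 0 < (σ : ℝ) ^ 2 / (2 * A * Real.exp 1) := by positivity
    have hμ : ∀ᵐ x ∂(P.map X), |x| ≤ A :=
      (ae_map_iff hX (measurableSet_le measurable_norm measurable_const)).2 hXA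
    -- The zero-free disc allows any radius below `σ² / (2 A)`; the factor `e > 1` supplies the
    -- strict inequality.
    have hlt : (((σ : ℝ) ^ 2 / (2 * A * Real.exp 1)).toNNReal : ℝ) < (σ : ℝ) ^ 2 / (2 * A) := by
      rw [Real.coe_toNNReal _ hpos.le]
      refine div_lt_div_of_pos_left (by positivity) (by positivity) ?_
      exact lt_mul_of_one_lt_right (by positivity) (Real.one_lt_exp_iff.2 one_pos)
    obtain ⟨q, hq⟩ := GaussianChannel.exists_hasFPowerSeriesOnBall_condMean (P.map X) hσ hA hμ a
      (Real.toNNReal_pos.2 hpos) hlt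
    -- Both series represent the conditional mean near `a`, so they coincide and share their radius.
    rw [hat.eq_formalMultilinearSeries hq.hasFPowerSeriesAt]
    exact hq.r_le
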